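/- Let $d\in\{2,3\}$ and let $\Omega\subset\mathbb R^d$ be an open bounded convex polygon/polyhedron. Write $(\cdot,\cdot)$ and $\|\cdot\|$ for the inner product and norm of $L^2(\Omega)$, $\mathbb D(\mathbf v)=\frac12(\nabla\mathbf v+\nabla\mathbf v^T)$, and put $$\mathcal X=H^1_0(\Omega)^d,\quad \mathcal W=\{\mathbf w\in H^1(\Omega)^d:\mathbf w\cdot\mathbf n|_{\partial\Omega}=0\},\quad \mathcal M=\Big\{q\in L^2(\Omega):\int_\Omega q\,dx=0\Big\}.$$ In dimension $2$, cross products and curls are taken after identifying $(v_1,v_2)$ with $(v_1,v_2,0)$. Let $c_0,c_1$ be constants such that $\|\mathbb D(\mathbf v)\|\ge c_0\|\nabla\mathbf v\|$ for all $\mathbf v\in\mathcal X$ and $c_1\|\nabla\mathbf w\|^2\le\|\operatorname{curl}\mathbf w\|^2+\|\operatorname{div}\mathbf w\|^2$ for all $\mathbf w\in\mathcal W$. Let $\mathbf K_h$ be a conforming triangulation of $\Omega$ into finitely many triangles/tetrahedra, let $r\ge 0$ be an integer, and let $\mathcal X_h,\mathcal M_h,\mathcal W_h$ be the spaces of those elements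 of $\mathcal X,\mathcal M,\mathcal W$ that are continuous on $\overline\Omega$ and polynomial on every element of $\mathbf K_h$, of degree at most $r+1$, $r$, $r+1$ respectively. Let $\mathcal Q_h$ be either the space of all $f\in H^1(\Omega)\cap C^0(\overline\Omega)$ that are polynomial of degree at most $r+1$ on every element, or its subspace of functions with $\partial f/\partial\mathbf n=0$ on $\partial\Omega$. Let $\epsilon,\lambda,S_c,T>0$, let $N\ge1$ be an integer, $\Delta t=T/N$, $t_n=n\Delta t$, and $\delta_t f^n=(f^n-f^{n-1})/\Delta t$. Let $\kappa,\nu,\eta$ be continuous on $\overline\Omega\times[0,T]\times\mathbb R$ with $0<\kappa_1\le\kappa\le\kappa_2$, $0<\nu_1\le\nu\le\nu_2$, $0<\eta_1\le\eta\le\eta_2$ on $\overline\Omega\times(0,T]\times\mathbb R$, and write $\kappa^n,\nu^n,\eta^n$ for the functions $\kappa(x,t_n,\phi_h^{n-1}(x))$, $\nu(x,t_n,\phi_h^{n-1}(x))$, $\eta(x,t_n,\phi_h^{n-1}(x))$. Let $b(\mathbf w,\mathbf u,\mathbf v)=\frac12\int_\Omega [(\mathbf w\cdot\nabla)\mathbf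 u]\cdot\mathbf v-[(\mathbf w\cdot\nabla)\mathbf v]\cdot\mathbf u\,dx$. Suppose that $(\phi_h^0,\mathbf u_h^0,\mathbf B_h^0)\in\mathcal Q_h\times\mathcal X_h\times\mathcal W_h$ and that $(\phi_h^n,\mu_h^n,\mathbf u_h^n,p_h^n,\mathbf B_h^n)\in\mathcal Q_h\times\mathcal Q_h\times\mathcal X_h\times\mathcal M_h\times\mathcal W_h$, $1\le n\le N$, satisfy for all $(\psi,\theta,\mathbf v,q,\mathbf H)\in\mathcal Q_h\times\mathcal Q_h\times\mathcal X_h\times\mathcal M_h\times\mathcal W_h$ $$\begin{aligned} &(\delta_t\phi_h^n,\psi)+\epsilon(\kappa^n\nabla\mu_h^n,\nabla\psi)+(\nabla\phi_h^{n-1}\cdot\mathbf u_h^n,\psi)=0,\\ &\epsilon^{-1}((\phi_h^n)^3-\phi_h^{n-1},\theta)+\epsilon(\nabla\phi_h^n,\nabla\theta)=(\mu_h^n,\theta),\\ &(\delta_t\mathbf u_h^n,\mathbf v)+2(\nu^n\mathbb D(\mathbf u_h^n),\mathbb D(\mathbf v))+b(\mathbf u_h^{n-1},\mathbf u_h^n,\mathbf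 v)+S_c(\mathbf B_h^{n-1}\times\operatorname{curl}\mathbf B_h^n,\mathbf v)-(p_h^n,\operatorname{div}\mathbf v)=\lambda(\mu_h^n\nabla\phi_h^{n-1},\mathbf v),\\ &(\operatorname{div}\mathbf u_h^n,q)=0,\\ &(\delta_t\mathbf B_h^n,\mathbf H)+(\eta^n\operatorname{curl}\mathbf B_h^n,\operatorname{curl}\mathbf H)+(\eta^n\operatorname{div}\mathbf B_h^n,\operatorname{div}\mathbf H)-(\mathbf u_h^n\times\mathbf B_h^{n-1},\operatorname{curl}\mathbf H)=0. \end{aligned}$$ With the energy $$\mathbf E(\phi,\mathbf u,\mathbf B)=\int_\Omega\Big(\tfrac12|\mathbf u|^2+\tfrac{S_c}2|\mathbf B|^2+\tfrac{\lambda\epsilon}2|\nabla\phi|^2+\tfrac{\lambda}{4\epsilon}(1-\phi^2)^2\Big)dx,$$ the following discrete energy law holds for every $0\le n\le N$: $$\begin{aligned} \mathbf E(\phi_h^n,\mathbf u_h^n,\mathbf B_h^n)&+\Delta t\sum_{m=1}^n\Big[\lambda\kappa_1\epsilon\|\nabla\mu_h^m\|^2+c_0\nu_1\|\nabla\mathbf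 u_h^m\|^2+S_cc_1\eta_1\|\nabla\mathbf B_h^m\|^2\Big]\\ &+\Delta t^2\sum_{m=1}^n\Big[\tfrac{\lambda\epsilon}2\|\nabla\delta_t\phi_h^m\|^2+\tfrac12\|\delta_t\mathbf u_h^m\|^2+\tfrac{S_c}2\|\delta_t\mathbf B_h^m\|^2\\ &\qquad+\tfrac{\lambda}{4\epsilon}\|\delta_t(\phi_h^m)^2\|^2+\tfrac{\lambda}{2\epsilon}\|\phi_h^m\delta_t\phi_h^m\|^2+\tfrac{\lambda}{2\epsilon}\|\delta_t\phi_h^m\|^2\Big]\le\mathbf E(\phi_h^0,\mathbf u_h^0,\mathbf B_h^0). \end{aligned}$$ In particular the scheme is unconditionally energy stable: $\mathbf E(\phi_h^{n},\mathbf u_h^{n},\mathbf B_h^{n})\le\mathbf E(\phi_h^{n-1},\mathbf u_h^{n-1},\mathbf B_h^{n-1})$ for $1\le n\le N$, without any restriction on $\Delta t$ or on the mesh. -/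

import Mathlib

open MeasureTheory Matrix
open scoped ContDiff

namespace CHMHD

noncomputable section

/-- The points of the Euclidean space `ℝ^d`. -/
abbrev Pt (d : ℕ) := EuclideanSpace ℝ (Fin d)

/-- Scalar functions on `ℝ^d`; only their values on `closure Ω` matter below. -/
abbrev Scal (d : ℕ) := Pt d → ℝ

/-- Vector fields on `ℝ^d`, given by their `d` components. -/
abbrev Vec (d : ℕ) := Pt d → Fin d → ℝ

/-! ### Sobolev spaces on an open set -/

/-- Classical gradient. -/
def classGrad {d : ℕ} (f : Scal d) (x : Pt d) : Fin d → ℝ :=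
  fun i => fderiv ℝ f x (EuclideanSpace.single i 1)

/-- `ζ ∈ C_c^∞(Ω)`. -/
def IsTest {d : ℕ} (Ω : Set (Pt d)) (ζ : Scal d) : Prop :=
  ContDiff ℝ ∞ ζ ∧ HasCompactSupport ζ ∧ tsupport ζ ⊆ Ω

/-- `g ∈ L²(Ω)^d` is the weak gradient of `f` in `Ω`. -/
def IsWeakGrad {d : ℕ} (Ω : Set (Pt d)) (f : Scal d) (g : Vec d) : Prop :=
  (∀ i, MemLp (fun x => g x i) 2 (volume.restrict Ω)) ∧
  ∀ i, ∀ ζ, IsTest Ω ζ →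
    ∫ x in Ω, f x * classGrad ζ x i = - ∫ x in Ω, g x i * ζ x

/-- `f ∈ H¹(Ω)`. -/
def MemH1 {d : ℕ} (Ω : Set (Pt d)) (f : Scal d) : Prop :=
  MemLp f 2 (volume.restrict Ω) ∧ ∃ g, IsWeakGrad Ω f g

open Classical in
/-- The weak gradient `∇f` of `f ∈ H¹(Ω)` (unique almost everywhere in `Ω`). -/
def grad {d : ℕ} (Ω : Set (Pt d)) (f : Scal d) : Vec d :=
  if h : ∃ g, IsWeakGrad Ω f g then h.choose else 0

/-- `f ∈ H¹₀(Ω)`, the closure of `C_c^∞(Ω)` in `H¹(Ω)`. -/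
def MemH10 {d : ℕ} (Ω : Set (Pt d)) (f : Scal d) : Prop :=
  MemH1 Ω f ∧ ∀ δ > 0, ∃ ζ, IsTest Ω ζ ∧
    (∫ x in Ω, (f x - ζ x) ^ 2) +
      (∫ x in Ω, (grad Ω f x - classGrad ζ x) ⬝ᵥ (grad Ω f x - classGrad ζ x)) < δ

/-! ### Differential operators on `H¹(Ω)^d` -/

/-- The matrix `∇u`, with entries `(∇u)_{ij} = ∂_j u_i`. -/
def gradV {d : ℕ} (Ω : Set (Pt d)) (u : Vec d) (x : Pt d) : Matrix (Fin d) (Fin d) ℝ :=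
  fun i j => grad Ω (fun y => u y i) x j

/-- The strain-rate tensor `𝔻(u) = (∇u + ∇uᵀ) / 2`. -/
def strain {d : ℕ} (Ω : Set (Pt d)) (u : Vec d) (x : Pt d) : Matrix (Fin d) (Fin d) ℝ :=
  (1 / 2 : ℝ) • (gradV Ω u x + (gradV Ω u x)ᵀ)

/-- The divergence. -/
def div {d : ℕ} (Ω : Set (Pt d)) (u : Vec d) (x : Pt d) : ℝ :=
  (gradV Ω u x).trace

/-- For `d = 2` the vector `(v₁, v₂)` is identified with `(v₁, v₂, 0)`; for `d = 3` this is the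
identity. The scalar cross product and the scalar curl of the planar case then are the third
components of the spatial ones. -/
def pad {d : ℕ} (v : Fin d → ℝ) : Fin 3 → ℝ :=
  fun i => if h : (i : ℕ) < d then v ⟨i, h⟩ else 0

/-- The corresponding identification for `∇u` (for `d = 2`, nothing depends on `x₃`). -/
def padM {d : ℕ} (A : Matrix (Fin d) (Fin d) ℝ) : Matrix (Fin 3) (Fin 3) ℝ :=
  fun i j => if h : (i : ℕ) < d ∧ (j : ℕ) < d then A ⟨i, h.1⟩ ⟨j, h.2⟩ else 0

/-- The curl: `(∂₂u₃ - ∂₃u₂, ∂₃u₁ - ∂₁u₃, ∂₁u₂ - ∂₂u₁)`. -/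
def curl {d : ℕ} (Ω : Set (Pt d)) (u : Vec d) (x : Pt d) : Fin 3 → ℝ :=
  let A := padM (gradV Ω u x)
  ![A 2 1 - A 1 2, A 0 2 - A 2 0, A 1 0 - A 0 1]

/-! ### Squared `L²(Ω)` norms -/

/-- Frobenius product `A : B`. -/
def frob {d : ℕ} (A B : Matrix (Fin d) (Fin d) ℝ) : ℝ := ∑ i, ∑ j, A i j * B i j

/-- `‖f‖²` for a scalar function. -/
def nsqS {d : ℕ} (Ω : Set (Pt d)) (f : Scal d) : ℝ := ∫ x in Ω, f x ^ 2

/-- `‖v‖²` for a function with values in some `ℝ^m`. -/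
def nsqV {d m : ℕ} (Ω : Set (Pt d)) (v : Pt d → Fin m → ℝ) : ℝ := ∫ x in Ω, v x ⬝ᵥ v x

/-- `‖A‖²` for a matrix-valued function. -/
def nsqM {d : ℕ} (Ω : Set (Pt d)) (A : Pt d → Matrix (Fin d) (Fin d) ℝ) : ℝ :=
  ∫ x in Ω, frob (A x) (A x)

/-! ### The continuous spaces -/

/-- `X = H¹₀(Ω)^d`. -/
def spaceX {d : ℕ} (Ω : Set (Pt d)) : Set (Vec d) :=
  {v | ∀ i, MemH10 Ω (fun x => v x i)}

/-- `W = {w ∈ H¹(Ω)^d : w · n = 0 on ∂Ω}`; the normal trace is the one given by Green's formula. -/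
def spaceW {d : ℕ} (Ω : Set (Pt d)) : Set (Vec d) :=
  {w | (∀ i, MemH1 Ω (fun x => w x i)) ∧
    ∀ q : Scal d, ContDiff ℝ ∞ q →
      ∫ x in Ω, (w x ⬝ᵥ classGrad q x + q x * div Ω w x) = 0}

/-- `M = L²₀(Ω)`. -/
def spaceM {d : ℕ} (Ω : Set (Pt d)) : Set (Scal d) :=
  {q | MemLp q 2 (volume.restrict Ω) ∧ ∫ x in Ω, q x = 0}

/-- `c` is a constant in Korn's inequality `c ‖∇v‖ ≤ ‖𝔻(v)‖` on `X`. -/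
def IsKornConst {d : ℕ} (Ω : Set (Pt d)) (c : ℝ) : Prop :=
  ∀ v ∈ spaceX Ω, c * √(nsqM Ω (gradV Ω v)) ≤ √(nsqM Ω (strain Ω v))

/-- `c` is a constant in the inequality `c ‖∇w‖² ≤ ‖curl w‖² + ‖div w‖²` on `W`. -/
def IsCurlDivConst {d : ℕ} (Ω : Set (Pt d)) (c : ℝ) : Prop :=
  ∀ w ∈ spaceW Ω, c * nsqM Ω (gradV Ω w) ≤ nsqV Ω (curl Ω w) + nsqS Ω (div Ω w)

/-! ### Domain, mesh and finite element spaces -/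

/-- `Ω` is an open bounded convex polygon or polyhedron. -/
def IsConvexPolytope {d : ℕ} (Ω : Set (Pt d)) : Prop :=
  IsOpen Ω ∧ Convex ℝ Ω ∧ ∃ V : Finset (Pt d), closure Ω = convexHull ℝ (V : Set (Pt d))

/-- `K` is a conforming triangulation of `Ω` into finitely many simplices. The triangles or
tetrahedra are the faces of `K` that have `d + 1` vertices. -/
def IsMesh {d : ℕ} (Ω : Set (Pt d)) (K : Geometry.SimplicialComplex ℝ (Pt d)) : Prop :=
  K.faces.Finite ∧ K.space = closure Ω

/-- On the convex hull of `s`, `f` is the polynomial `p`, and `p` has degree at most `k`. -/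
def IsPolyOn {d : ℕ} (k : ℕ) (s : Finset (Pt d)) (f : Scal d) (p : MvPolynomial (Fin d) ℝ) :
    Prop :=
  p.totalDegree ≤ k ∧ ∀ x ∈ convexHull ℝ (s : Set (Pt d)), f x = MvPolynomial.eval (fun i => x i) p

/-- Continuous functions on `closure Ω` that are polynomials of degree at most `k` on each
element of the mesh. -/
def piecewisePoly {d : ℕ} (Ω : Set (Pt d)) (K : Geometry.SimplicialComplex ℝ (Pt d)) (k : ℕ) :
    Set (Scal d) :=
  {f | ContinuousOn f (closure Ω) ∧
    ∀ s ∈ K.faces, s.card = d + 1 → ∃ p, IsPolyOn k s f p}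

/-- `X_h`. -/
def fespaceX {d : ℕ} (Ω : Set (Pt d)) (K : Geometry.SimplicialComplex ℝ (Pt d)) (r : ℕ) :
    Set (Vec d) :=
  {v | v ∈ spaceX Ω ∧ ∀ i, (fun x => v x i) ∈ piecewisePoly Ω K (r + 1)}

/-- `M_h`. -/
def fespaceM {d : ℕ} (Ω : Set (Pt d)) (K : Geometry.SimplicialComplex ℝ (Pt d)) (r : ℕ) :
    Set (Scal d) :=
  {q | q ∈ spaceM Ω ∧ q ∈ piecewisePoly Ω K r}

/-- `W_h`. -/
def fespaceW {d : ℕ} (Ω : Set (Pt d)) (K : Geometry.SimplicialComplex ℝ (Pt d)) (r : ℕ) :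
    Set (Vec d) :=
  {w | w ∈ spaceW Ω ∧ ∀ i, (fun x => w x i) ∈ piecewisePoly Ω K (r + 1)}

/-- `Q_h`, the homogeneous Neumann condition being left to the weak formulation. -/
def fespaceQ {d : ℕ} (Ω : Set (Pt d)) (K : Geometry.SimplicialComplex ℝ (Pt d)) (r : ℕ) :
    Set (Scal d) :=
  {f | MemH1 Ω f ∧ f ∈ piecewisePoly Ω K (r + 1)}

/-- `Q_h`, with `∂f/∂n = 0` imposed on `∂Ω`: the polynomial that `f` is on an element has vanishing
normal derivative on every facet of that element that lies in `∂Ω`. -/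
def fespaceQNeumann {d : ℕ} (Ω : Set (Pt d)) (K : Geometry.SimplicialComplex ℝ (Pt d)) (r : ℕ) :
    Set (Scal d) :=
  {f | f ∈ fespaceQ Ω K r ∧
    ∀ s ∈ K.faces, s.card = d + 1 → ∃ p, IsPolyOn (r + 1) s f p ∧
      ∀ t ⊆ s, t.card = d → convexHull ℝ (t : Set (Pt d)) ⊆ frontier Ω →
        ∀ n : Pt d, (∀ y ∈ t, ∀ z ∈ t, inner ℝ n (y - z) = 0) →
          ∀ x ∈ convexHull ℝ (t : Set (Pt d)),
            ∑ i, MvPolynomial.eval (fun j => x j) (MvPolynomial.pderiv i p) * n i = 0}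

/-! ### Forms; `k` is the coefficient as a function of the point -/

/-- `(f, g)` for scalar functions. -/
def ipS {d : ℕ} (Ω : Set (Pt d)) (f g : Scal d) : ℝ := ∫ x in Ω, f x * g x

/-- `(v, w)` for vector fields. -/
def ipV {d : ℕ} (Ω : Set (Pt d)) (v w : Vec d) : ℝ := ∫ x in Ω, v x ⬝ᵥ w x

/-- `a_φ(f, g) = ∫ k ∇f · ∇g`. -/
def aPhi {d : ℕ} (Ω : Set (Pt d)) (k : Scal d) (f g : Scal d) : ℝ :=
  ∫ x in Ω, k x * (grad Ω f x ⬝ᵥ grad Ω g x)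

/-- `a_f(u, v) = ∫ 2 k 𝔻(u) : 𝔻(v)`. -/
def aF {d : ℕ} (Ω : Set (Pt d)) (k : Scal d) (u v : Vec d) : ℝ :=
  ∫ x in Ω, 2 * k x * frob (strain Ω u x) (strain Ω v x)

/-- `a_B(B, H) = ∫ k curl B · curl H + ∫ k div B div H`. -/
def aB {d : ℕ} (Ω : Set (Pt d)) (k : Scal d) (B H : Vec d) : ℝ :=
  (∫ x in Ω, k x * (curl Ω B x ⬝ᵥ curl Ω H x)) + ∫ x in Ω, k x * (div Ω B x * div Ω H x)

/-- `d(v, q) = ∫ q div v`. -/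
def dForm {d : ℕ} (Ω : Set (Pt d)) (v : Vec d) (q : Scal d) : ℝ :=
  ∫ x in Ω, q x * div Ω v x

/-- `b(w, u, v) = ½ ∫ ((w · ∇)u) · v - ((w · ∇)v) · u`. -/
def bForm {d : ℕ} (Ω : Set (Pt d)) (w u v : Vec d) : ℝ :=
  (1 / 2) * ∫ x in Ω, ((gradV Ω u x *ᵥ w x) ⬝ᵥ v x - (gradV Ω v x *ᵥ w x) ⬝ᵥ u x)

/-- `∫ (H × curl B) · v`. -/
def cHat {d : ℕ} (Ω : Set (Pt d)) (H B v : Vec d) : ℝ :=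
  ∫ x in Ω, (crossProduct (pad (H x)) (curl Ω B x)) ⬝ᵥ pad (v x)

/-- `∫ (u × B) · curl H`. -/
def cTilde {d : ℕ} (Ω : Set (Pt d)) (u B H : Vec d) : ℝ :=
  ∫ x in Ω, (crossProduct (pad (u x)) (pad (B x))) ⬝ᵥ curl Ω H x

/-! ### Coefficients, scheme and energy -/

/-- The coefficient function is continuous on `closure Ω × [0, T] × ℝ`, and
`0 < k₁ ≤ k ≤ k₂` on `closure Ω × (0, T] × ℝ`. -/
def IsCoeff {d : ℕ} (Ω : Set (Pt d)) (T : ℝ) (k : Pt d → ℝ → ℝ → ℝ) (k₁ k₂ : ℝ) : Prop :=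
  ContinuousOn (fun z : Pt d × ℝ × ℝ => k z.1 z.2.1 z.2.2)
    (closure Ω ×ˢ (Set.Icc 0 T ×ˢ Set.univ)) ∧
  0 < k₁ ∧ ∀ x ∈ closure Ω, ∀ t ∈ Set.Ioc 0 T, ∀ s : ℝ, k₁ ≤ k x t s ∧ k x t s ≤ k₂

/-- The difference quotient `δ_t f^n = (f^n - f^{n-1}) / Δt`, at `n = m + 1`. -/
def dt {V : Type*} [AddCommGroup V] [Module ℝ V] (Δt : ℝ) (f : ℕ → V) (m : ℕ) : V :=
  Δt⁻¹ • (f (m + 1) - f m)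

/-- The coefficient `k(x, t_n, φ^{n-1}(x))`, at `n = m + 1`. -/
def coeffAt {d : ℕ} (Δt : ℝ) (k : Pt d → ℝ → ℝ → ℝ) (φ : ℕ → Scal d) (m : ℕ) : Scal d :=
  fun x => k x ((m + 1 : ℕ) * Δt) (φ m x)

/-- `(φ^n, μ^n, u^n, p^n, B^n)`, `n = 1, …, N`, together with the initial values `φ^0, u^0, B^0`,
solves the convex-splitting Euler scheme. In the equations `n = m + 1`. -/
structure IsSolution {d : ℕ} (Ω : Set (Pt d)) (Qh : Set (Scal d)) (Xh : Set (Vec d))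
    (Mh : Set (Scal d)) (Wh : Set (Vec d)) (ε lam Sc Δt : ℝ) (N : ℕ)
    (κ ν η : Pt d → ℝ → ℝ → ℝ)
    (φ μ : ℕ → Scal d) (u : ℕ → Vec d) (p : ℕ → Scal d) (B : ℕ → Vec d) : Prop where
  phi_mem : ∀ n ≤ N, φ n ∈ Qh
  u_mem : ∀ n ≤ N, u n ∈ Xh
  B_mem : ∀ n ≤ N, B n ∈ Wh
  mu_mem : ∀ m < N, μ (m + 1) ∈ Qh
  p_mem : ∀ m < N, p (m + 1) ∈ Mh
  eq_phi : ∀ m < N, ∀ ψ ∈ Qh,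
    ipS Ω (dt Δt φ m) ψ + ε * aPhi Ω (coeffAt Δt κ φ m) (μ (m + 1)) ψ
      + ipS Ω (fun x => grad Ω (φ m) x ⬝ᵥ u (m + 1) x) ψ = 0
  eq_mu : ∀ m < N, ∀ θ ∈ Qh,
    ε⁻¹ * ipS Ω (fun x => φ (m + 1) x ^ 3 - φ m x) θ
      + ε * ipV Ω (grad Ω (φ (m + 1))) (grad Ω θ) = ipS Ω (μ (m + 1)) θ
  eq_u : ∀ m < N, ∀ v ∈ Xh,
    ipV Ω (dt Δt u m) v + aF Ω (coeffAt Δt ν φ m) (u (m + 1)) v + bForm Ω (u m) (u (m + 1)) v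
      + Sc * cHat Ω (B m) (B (m + 1)) v - dForm Ω v (p (m + 1))
      = lam * ipV Ω (fun x => μ (m + 1) x • grad Ω (φ m) x) v
  eq_div : ∀ m < N, ∀ q ∈ Mh, dForm Ω (u (m + 1)) q = 0
  eq_B : ∀ m < N, ∀ H ∈ Wh,
    ipV Ω (dt Δt B m) H + aB Ω (coeffAt Δt η φ m) (B (m + 1)) H
      - cTilde Ω (u (m + 1)) (B m) H = 0

/-- The energy `E(φ, u, B)`. -/
def energy {d : ℕ} (Ω : Set (Pt d)) (ε lam Sc : ℝ) (φ : Scal d) (u B : Vec d) : ℝ :=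
  ∫ x in Ω, (1 / 2 * (u x ⬝ᵥ u x) + Sc / 2 * (B x ⬝ᵥ B x)
    + lam * ε / 2 * (grad Ω φ x ⬝ᵥ grad Ω φ x) + lam / (4 * ε) * (1 - φ x ^ 2) ^ 2)

end

end CHMHD

/-! The energy law comes from testing the scheme with its own solution: `ψ = μ^n`, `θ = δ_t φ^n`, `v
= u^n`, `q = p^n`, `H = B^n`, with weights `lam`, `lam`, `1` and `Sc` on the phase, potential,
momentum and induction equations. All couplings then cancel. The terms `(δ_t φ^n, μ^n)` cancel
between the first two equations, phase transport cancels the work of the capillary force, and the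
Lorentz work cancels the induction term because the triple product is cyclic. The convection form
vanishes by skew symmetry and the pressure term by the divergence constraint.

What remains are time differences and dissipation. The quadratic terms follow from `2(a - b)·a =
|a|² - |b|² + |a - b|²`. The double well follows from its convex splitting, cubic term implicit and
linear term explicit, for which `(a³ - b)(a - b) = ¼(1 - a²)² - ¼(1 - b²)² + ¼(a² - b²)² + ½a²(a -
b)² + ½(a - b)²`. Hence each step satisfies an exact balance, `IsSolution.energy_balance`, whose
squares are the numerical dissipation. No smallness of `Δt` enters.

The inequality arises only when the dissipation is bounded below through the coefficient bounds, the
curl-div inequality and Korn's inequality. The Korn constant is assumed for norms but appears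
linearly in front of `‖∇u‖²`. This is settled by `‖𝔻(v)‖² ≤ ‖∇v‖² ≤ 2‖𝔻(v)‖²` on `X`, where the
second bound rests on `∫ ∇v : ∇vᵀ = ∫ (div v)²`. -/

namespace CHMHD

/-! ### Weak gradients -/

section WeakGradient

variable {d : ℕ} {Ω : Set (Pt d)}

lemma MemH1.isWeakGrad {f : Scal d} (h : MemH1 Ω f) : IsWeakGrad Ω f (grad Ω f) := by
  have h' := h.2
  rw [grad, dif_pos h']
  exact h'.choose_spec

lemma IsTest.contDiff_classGrad {ζ : Scal d} (h : IsTest Ω ζ) (i : Fin d) :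
    ContDiff ℝ ∞ (fun x => classGrad ζ x i) :=
  (h.1.fderiv_right (m := ∞) le_rfl).clm_apply contDiff_const

lemma IsTest.classGrad {ζ : Scal d} (h : IsTest Ω ζ) (i : Fin d) :
    IsTest Ω (fun x => classGrad ζ x i) := by
  refine ⟨h.contDiff_classGrad i, h.2.1.fderiv_apply (𝕜 := ℝ) _, ?_⟩
  exact (tsupport_fderiv_apply_subset ℝ _).trans h.2.2

lemma IsTest.memLp {ζ : Scal d} (h : IsTest Ω ζ) : MemLp ζ 2 (volume.restrict Ω) :=
  (h.1.continuous.memLp_of_hasCompactSupport h.2.1).restrict Ω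

lemma IsTest.classGrad_classGrad_comm {ζ : Scal d} (h : IsTest Ω ζ) (i j : Fin d) (x : Pt d) :
    CHMHD.classGrad (fun y => CHMHD.classGrad ζ y i) x j
      = CHMHD.classGrad (fun y => CHMHD.classGrad ζ y j) x i := by
  have hd : DifferentiableAt ℝ (fderiv ℝ ζ) x :=
    ((h.1.fderiv_right (m := ∞) le_rfl).differentiable (by simp)) x
  have hs : IsSymmSndFDerivAt ℝ ζ x := h.1.contDiffAt.isSymmSndFDerivAt (by
    rw [minSmoothness_of_isRCLikeNormedField]; exact WithTop.coe_le_coe.2 le_top)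
  have key : ∀ a b : Fin d, CHMHD.classGrad (fun y => CHMHD.classGrad ζ y a) x b
      = fderiv ℝ (fderiv ℝ ζ) x (EuclideanSpace.single b 1) (EuclideanSpace.single a 1) := by
    intro a b
    simp only [CHMHD.classGrad]
    rw [fderiv_clm_apply hd (differentiableAt_const _)]
    simp
  rw [key, key]
  exact hs _ _

lemma integrable_mul_of_memLp_two {α : Type*} [MeasurableSpace α] {μ : Measure α} {f g : α → ℝ}
    (hf : MemLp f 2 μ) (hg : MemLp g 2 μ) : Integrable (fun x => f x * g x) μ :=
  hf.integrable_mul hg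

/-- The fundamental lemma of the calculus of variations. It is needed because `grad` is picked by
choice for each function separately, so its linearity holds only almost everywhere. -/
lemma IsWeakGrad.ae_eq (hΩ : IsOpen Ω) {f : Scal d} {g g' : Vec d} (hg : IsWeakGrad Ω f g)
    (hg' : IsWeakGrad Ω f g') : g =ᵐ[volume.restrict Ω] g' := by
  have key : ∀ i, ∀ᵐ x ∂(volume.restrict Ω), g x i - g' x i = 0 := by
    intro i
    have hL : MemLp (fun x => g x i - g' x i) 2 (volume.restrict Ω) := (hg.1 i).sub (hg'.1 i)
    rw [ae_restrict_iff' hΩ.measurableSet]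
    refine hΩ.ae_eq_zero_of_integral_contDiff_smul_eq_zero (μ := volume)
      (locallyIntegrableOn_of_locallyIntegrable_restrict (hL.locallyIntegrable (by norm_num))) ?_
    intro ζ h1 h2 h3
    have hζ : IsTest Ω ζ := ⟨h1, h2, h3⟩
    have hsupp : ∫ x in Ω, ζ x • (g x i - g' x i) = ∫ x, ζ x • (g x i - g' x i) := by
      apply setIntegral_eq_integral_of_forall_compl_eq_zero
      intro x hx
      rw [image_eq_zero_of_notMem_tsupport (fun hx' => hx (h3 hx')), zero_smul]
    rw [← hsupp]
    have e : ∀ x, ζ x • (g x i - g' x i) = g x i * ζ x - g' x i * ζ x := by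
      intro x; rw [smul_eq_mul]; ring
    simp_rw [e]
    rw [integral_sub (integrable_mul_of_memLp_two (hg.1 i) hζ.memLp)
      (integrable_mul_of_memLp_two (hg'.1 i) hζ.memLp)]
    have e1 := hg.2 i ζ hζ
    have e2 := hg'.2 i ζ hζ
    linarith
  filter_upwards [ae_all_iff.2 key] with x hx
  funext i
  exact sub_eq_zero.1 (hx i)

lemma IsWeakGrad.smul_sub {f f' : Scal d} {g g' : Vec d} (hf : MemLp f 2 (volume.restrict Ω))
    (hf' : MemLp f' 2 (volume.restrict Ω)) (hg : IsWeakGrad Ω f g) (hg' : IsWeakGrad Ω f' g')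
    (c : ℝ) : IsWeakGrad Ω (c • (f - f')) (c • (g - g')) := by
  refine ⟨fun i => ((hg.1 i).sub (hg'.1 i)).const_mul c, fun i ζ hζ => ?_⟩
  have e1 : ∀ x, (c • (f - f')) x * CHMHD.classGrad ζ x i
      = c * (f x * CHMHD.classGrad ζ x i - f' x * CHMHD.classGrad ζ x i) := by
    intro x; simp only [Pi.smul_apply, Pi.sub_apply, smul_eq_mul]; ring
  have e2 : ∀ x, (c • (g - g')) x i * ζ x = c * (g x i * ζ x - g' x i * ζ x) := by
    intro x; simp only [Pi.smul_apply, Pi.sub_apply, smul_eq_mul]; ring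
  simp_rw [e1, e2]
  rw [integral_const_mul, integral_const_mul,
    integral_sub (integrable_mul_of_memLp_two hf (hζ.classGrad i).memLp)
      (integrable_mul_of_memLp_two hf' (hζ.classGrad i).memLp),
    integral_sub (integrable_mul_of_memLp_two (hg.1 i) hζ.memLp)
      (integrable_mul_of_memLp_two (hg'.1 i) hζ.memLp), hg.2 i ζ hζ, hg'.2 i ζ hζ]
  ring

lemma MemH1.smul_sub {f f' : Scal d} (h : MemH1 Ω f) (h' : MemH1 Ω f') (c : ℝ) :
    MemH1 Ω (c • (f - f')) :=
  ⟨(h.1.sub h'.1).const_smul c, _, h.isWeakGrad.smul_sub h.1 h'.1 h'.isWeakGrad c⟩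

lemma grad_smul_sub_ae (hΩ : IsOpen Ω) {f f' : Scal d} (h : MemH1 Ω f) (h' : MemH1 Ω f')
    (c : ℝ) :
    grad Ω (c • (f - f')) =ᵐ[volume.restrict Ω] c • (grad Ω f - grad Ω f') :=
  (h.smul_sub h' c).isWeakGrad.ae_eq hΩ (h.isWeakGrad.smul_sub h.1 h'.1 h'.isWeakGrad c)

end WeakGradient

/-! ### Integrability of products -/

section Products

variable {α : Type*} [MeasurableSpace α] {P : Measure α}

lemma integrable_dotProduct {m : ℕ} {v w : α → Fin m → ℝ} (hv : ∀ i, MemLp (fun x => v x i) 2 P)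
    (hw : ∀ i, MemLp (fun x => w x i) 2 P) : Integrable (fun x => v x ⬝ᵥ w x) P :=
  integrable_finsetSum _ fun i _ => integrable_mul_of_memLp_two (hv i) (hw i)

lemma integrable_frob {d : ℕ} {A B : α → Matrix (Fin d) (Fin d) ℝ}
    (hA : ∀ i j, MemLp (fun x => A x i j) 2 P) (hB : ∀ i j, MemLp (fun x => B x i j) 2 P) :
    Integrable (fun x => frob (A x) (B x)) P :=
  integrable_finsetSum _ fun i _ => integrable_finsetSum _ fun j _ =>
    integrable_mul_of_memLp_two (hA i j) (hB i j)

lemma integral_sub_dotProduct_self {m : ℕ} {v w : α → Fin m → ℝ}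
    (hv : ∀ i, MemLp (fun x => v x i) 2 P) (hw : ∀ i, MemLp (fun x => w x i) 2 P) :
    ∫ x, (v x - w x) ⬝ᵥ v x ∂P
      = 1 / 2 * (∫ x, v x ⬝ᵥ v x ∂P) - 1 / 2 * (∫ x, w x ⬝ᵥ w x ∂P)
        + 1 / 2 * ∫ x, (v x - w x) ⬝ᵥ (v x - w x) ∂P := by
  have h1 := integrable_dotProduct hv hv
  have h2 := integrable_dotProduct hw hw
  have hs : ∀ i, MemLp (fun x => (v x - w x) i) 2 P := fun i => (hv i).sub (hw i)
  have h3 := integrable_dotProduct hs hs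
  rw [← integral_const_mul, ← integral_const_mul, ← integral_const_mul,
    ← integral_sub (h1.const_mul _) (h2.const_mul _), ← integral_add _ (h3.const_mul _)]
  swap
  · exact (h1.const_mul _).sub (h2.const_mul _)
  congr 1 with x
  simp only [sub_dotProduct, dotProduct_sub, dotProduct_comm (w x) (v x)]
  ring

/-- Young's inequality with weight `t`: the gap between the integrands is a square divided by `2t`.
-/
lemma abs_integral_mul_le {f g : α → ℝ} (hf : MemLp f 2 P) (hg : MemLp g 2 P) {t : ℝ}
    (ht : 0 < t) :
    |∫ x, f x * g x ∂P| ≤ t / 2 * (∫ x, f x ^ 2 ∂P) + 1 / (2 * t) * ∫ x, g x ^ 2 ∂P := by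
  rw [← integral_const_mul, ← integral_const_mul,
    ← integral_add (hf.integrable_sq.const_mul _) (hg.integrable_sq.const_mul _)]
  refine (abs_integral_le_integral_abs).trans
    (integral_mono (integrable_mul_of_memLp_two hf hg).abs
      ((hf.integrable_sq.const_mul _).add (hg.integrable_sq.const_mul _)) fun x => ?_)
  have e : t / 2 * f x ^ 2 + 1 / (2 * t) * g x ^ 2 - |f x * g x|
      = (t * |f x| - |g x|) ^ 2 / (2 * t) := by
    rw [abs_mul, ← sq_abs (f x), ← sq_abs (g x)]
    field_simp
    ring
  have : 0 ≤ (t * |f x| - |g x|) ^ 2 / (2 * t) := by positivity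
  simp only
  linarith

end Products

/-! ### Korn's first inequality on `H¹₀` -/

section Korn

variable {d : ℕ} {Ω : Set (Pt d)}

lemma spaceX.memH1 {v : Vec d} (hv : v ∈ spaceX Ω) (i : Fin d) : MemH1 Ω (fun x => v x i) :=
  (hv i).1

lemma memLp_gradV {v : Vec d} (hv : ∀ i, MemH1 Ω (fun x => v x i)) (i j : Fin d) :
    MemLp (fun x => gradV Ω v x i j) 2 (volume.restrict Ω) :=
  (hv i).isWeakGrad.1 j

lemma memLp_strain {v : Vec d} (hv : ∀ i, MemH1 Ω (fun x => v x i)) (i j : Fin d) :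
    MemLp (fun x => strain Ω v x i j) 2 (volume.restrict Ω) :=
  ((memLp_gradV hv i j).add (memLp_gradV hv j i)).const_mul _

lemma memLp_div {v : Vec d} (hv : ∀ i, MemH1 Ω (fun x => v x i)) :
    MemLp (div Ω v) 2 (volume.restrict Ω) :=
  memLp_finsetSum Finset.univ fun i _ => memLp_gradV hv i i

/-- Both sides are `-∫ f ∂_i ∂_j ζ`, since the second derivatives of a test function commute. -/
lemma IsWeakGrad.integral_mul_classGrad_comm {f : Scal d} {g : Vec d} (hg : IsWeakGrad Ω f g)
    {ζ : Scal d} (hζ : IsTest Ω ζ) (i j : Fin d) :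
    ∫ x in Ω, g x i * classGrad ζ x j = ∫ x in Ω, g x j * classGrad ζ x i := by
  have h1 := hg.2 i _ (hζ.classGrad j)
  have h2 := hg.2 j _ (hζ.classGrad i)
  simp_rw [hζ.classGrad_classGrad_comm j i] at h1
  linarith

/-- For a test function in place of `f'` this is the previous lemma; density of test functions in
`H¹₀` carries it over. Only one of the two factors has to vanish on the boundary. -/
lemma integral_grad_mul_grad_comm {f f' : Scal d} (hf : MemH1 Ω f) (hf' : MemH10 Ω f')
    (i j : Fin d) :
    ∫ x in Ω, grad Ω f x i * grad Ω f' x j = ∫ x in Ω, grad Ω f x j * grad Ω f' x i := by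
  have hg := hf.isWeakGrad
  have hg' := hf'.1.isWeakGrad
  set M : ℝ := (∫ x in Ω, grad Ω f x i ^ 2) + ∫ x in Ω, grad Ω f x j ^ 2 with hM
  set D : ℝ := (∫ x in Ω, grad Ω f x i * grad Ω f' x j) - ∫ x in Ω, grad Ω f x j * grad Ω f' x i
    with hD
  have bound : ∀ t > 0, |D| ≤ t * (M / 2 + 1) := by
    intro t ht
    -- With squared error `t²`, the factor `1 / (2t)` in Young's inequality leaves `t / 2` for each
    -- of the two integrals.
    obtain ⟨ζ, hζ, hlt⟩ := hf'.2 (t ^ 2) (by positivity)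
    have hL : ∀ k, MemLp (fun x => grad Ω f' x k - classGrad ζ x k) 2 (volume.restrict Ω) :=
      fun k => (hg'.1 k).sub (hζ.classGrad k).memLp
    have hsmall : ∀ k, ∫ x in Ω, (grad Ω f' x k - classGrad ζ x k) ^ 2 ≤ t ^ 2 := by
      intro k
      have h1 : ∫ x in Ω, (grad Ω f' x k - classGrad ζ x k) ^ 2
          ≤ ∫ x in Ω, (grad Ω f' x - classGrad ζ x) ⬝ᵥ (grad Ω f' x - classGrad ζ x) := by
        refine integral_mono (hL k).integrable_sq (integrable_dotProduct hL hL) fun x => ?_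
        have := Finset.single_le_sum (f := fun l => (grad Ω f' x l - classGrad ζ x l) ^ 2)
          (fun l _ => sq_nonneg _) (Finset.mem_univ k)
        refine this.trans (le_of_eq ?_)
        simp only [dotProduct, Pi.sub_apply, sq]
      have h2 : 0 ≤ ∫ x in Ω, (f' x - ζ x) ^ 2 := integral_nonneg fun x => sq_nonneg _
      linarith
    have split : ∀ k l, ∫ x in Ω, grad Ω f x k * (grad Ω f' x l - classGrad ζ x l)
        = (∫ x in Ω, grad Ω f x k * grad Ω f' x l)
          - ∫ x in Ω, grad Ω f x k * classGrad ζ x l := by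
      intro k l
      simp_rw [mul_sub]
      exact integral_sub (integrable_mul_of_memLp_two (hg.1 k) (hg'.1 l))
        (integrable_mul_of_memLp_two (hg.1 k) (hζ.classGrad l).memLp)
    have hDeq : D = (∫ x in Ω, grad Ω f x i * (grad Ω f' x j - classGrad ζ x j))
        - ∫ x in Ω, grad Ω f x j * (grad Ω f' x i - classGrad ζ x i) := by
      rw [split, split, hg.integral_mul_classGrad_comm hζ i j, hD]
      ring
    have b1 := abs_integral_mul_le (hg.1 i) (hL j) ht
    have b2 := abs_integral_mul_le (hg.1 j) (hL i) ht
    have e : 1 / (2 * t) * t ^ 2 = t / 2 := by field_simp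
    have c1 := mul_le_mul_of_nonneg_left (hsmall j) (by positivity : 0 ≤ 1 / (2 * t))
    have c2 := mul_le_mul_of_nonneg_left (hsmall i) (by positivity : 0 ≤ 1 / (2 * t))
    rw [e] at c1 c2
    rw [hDeq]
    refine (abs_sub _ _).trans ?_
    rw [hM]
    linarith
  have hM0 : 0 ≤ M := add_nonneg (integral_nonneg fun x => sq_nonneg _)
    (integral_nonneg fun x => sq_nonneg _)
  have : |D| ≤ 0 := by
    refine le_of_forall_pos_le_add fun δ hδ => ?_
    have := bound (δ / (M / 2 + 1)) (by positivity)
    rwa [div_mul_cancel₀ _ (by positivity), ← zero_add δ] at this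
  exact sub_eq_zero.1 (abs_eq_zero.1 (le_antisymm this (abs_nonneg _)))

/-- Exchanging the two derivatives in every product `∂_j v_i ∂_i v_j` turns the integral into that
of `(div v)²`. -/
lemma integral_frob_gradV_transpose_nonneg {v : Vec d} (hv : v ∈ spaceX Ω) :
    0 ≤ ∫ x in Ω, frob (gradV Ω v x) (gradV Ω v x)ᵀ := by
  have hL := memLp_gradV (spaceX.memH1 hv)
  have h : ∫ x in Ω, frob (gradV Ω v x) (gradV Ω v x)ᵀ = ∫ x in Ω, div Ω v x ^ 2 := by
    have e : ∀ x, div Ω v x ^ 2 = ∑ i, ∑ j, gradV Ω v x i i * gradV Ω v x j j := by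
      intro x
      rw [sq, div, trace, Finset.sum_mul_sum]
      rfl
    simp_rw [e, frob, transpose_apply]
    rw [integral_finsetSum _ fun i _ => integrable_finsetSum _ fun j _ =>
        integrable_mul_of_memLp_two (hL i j) (hL j i),
      integral_finsetSum _ fun i _ => integrable_finsetSum _ fun j _ =>
        integrable_mul_of_memLp_two (hL i i) (hL j j)]
    refine Finset.sum_congr rfl fun i _ => ?_
    rw [integral_finsetSum _ fun j _ => integrable_mul_of_memLp_two (hL i j) (hL j i),
      integral_finsetSum _ fun j _ => integrable_mul_of_memLp_two (hL i i) (hL j j)]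
    exact Finset.sum_congr rfl fun j _ => integral_grad_mul_grad_comm (hv i).1 (hv j) j i
  rw [h]
  exact integral_nonneg fun x => sq_nonneg _

lemma frob_self_nonneg (A : Matrix (Fin d) (Fin d) ℝ) : 0 ≤ frob A A :=
  Finset.sum_nonneg fun _ _ => Finset.sum_nonneg fun _ _ => mul_self_nonneg _

lemma nsqM_nonneg (A : Pt d → Matrix (Fin d) (Fin d) ℝ) : 0 ≤ nsqM Ω A :=
  integral_nonneg fun x => frob_self_nonneg (A x)

lemma frob_symm_part_self (A : Matrix (Fin d) (Fin d) ℝ) :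
    frob ((1 / 2 : ℝ) • (A + Aᵀ)) ((1 / 2 : ℝ) • (A + Aᵀ)) = 1 / 2 * frob A A + 1 / 2 * frob A Aᵀ := by
  have hT : frob Aᵀ Aᵀ = frob A A := by
    simp only [frob, transpose_apply]
    exact Finset.sum_comm
  have h : frob ((1 / 2 : ℝ) • (A + Aᵀ)) ((1 / 2 : ℝ) • (A + Aᵀ))
      = 1 / 4 * frob A A + 1 / 4 * frob Aᵀ Aᵀ + 1 / 2 * frob A Aᵀ := by
    simp only [frob, Finset.mul_sum, ← Finset.sum_add_distrib]
    refine Finset.sum_congr rfl fun i _ => Finset.sum_congr rfl fun j _ => ?_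
    simp only [Matrix.smul_apply, Matrix.add_apply, transpose_apply, smul_eq_mul]
    ring
  rw [h, hT]
  ring

lemma frob_transpose_le (A : Matrix (Fin d) (Fin d) ℝ) : frob A Aᵀ ≤ frob A A := by
  have hT : frob Aᵀ Aᵀ = frob A A := by
    simp only [frob, transpose_apply]
    exact Finset.sum_comm
  have h : 0 ≤ frob (A - Aᵀ) (A - Aᵀ) := frob_self_nonneg _
  have e : frob (A - Aᵀ) (A - Aᵀ) = frob A A + frob Aᵀ Aᵀ - 2 * frob A Aᵀ := by
    simp only [frob, Finset.mul_sum, ← Finset.sum_add_distrib, ← Finset.sum_sub_distrib]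
    refine Finset.sum_congr rfl fun i _ => Finset.sum_congr rfl fun j _ => ?_
    simp only [Matrix.sub_apply, transpose_apply]
    ring
  linarith

lemma nsqM_gradV_le_two_mul_nsqM_strain {v : Vec d} (hv : v ∈ spaceX Ω) :
    nsqM Ω (gradV Ω v) ≤ 2 * nsqM Ω (strain Ω v) := by
  have hL := memLp_gradV (spaceX.memH1 hv)
  have h : nsqM Ω (strain Ω v)
      = 1 / 2 * nsqM Ω (gradV Ω v) + 1 / 2 * ∫ x in Ω, frob (gradV Ω v x) (gradV Ω v x)ᵀ := by
    simp only [nsqM, strain, frob_symm_part_self]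
    have hI : Integrable (fun x => frob (gradV Ω v x) (gradV Ω v x)ᵀ) (volume.restrict Ω) :=
      integrable_frob hL fun i j => hL j i
    rw [integral_add ((integrable_frob hL hL).const_mul _) (hI.const_mul _), integral_const_mul,
      integral_const_mul]
  have := integral_frob_gradV_transpose_nonneg hv
  linarith

lemma nsqM_strain_le_nsqM_gradV {v : Vec d} (hv : v ∈ spaceX Ω) :
    nsqM Ω (strain Ω v) ≤ nsqM Ω (gradV Ω v) := by
  have hL := memLp_gradV (spaceX.memH1 hv)
  have hS := memLp_strain (spaceX.memH1 hv)
  refine integral_mono (integrable_frob hS hS) (integrable_frob hL hL) fun x => ?_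
  have := frob_transpose_le (gradV Ω v x)
  simp only [strain, frob_symm_part_self]
  linarith

/-- A constant in Korn's inequality is at most `1` unless `X` is trivial, so that it bounds
`2 ‖𝔻(v)‖²` from below although it enters linearly. -/
lemma IsKornConst.mul_nsqM_gradV_le {c : ℝ} (hc : IsKornConst Ω c) {v : Vec d}
    (hv : v ∈ spaceX Ω) : c * nsqM Ω (gradV Ω v) ≤ 2 * nsqM Ω (strain Ω v) := by
  have h := hc v hv
  have h1 := nsqM_gradV_le_two_mul_nsqM_strain hv
  have h2 := Real.sqrt_le_sqrt (nsqM_strain_le_nsqM_gradV hv)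
  have h3 := Real.mul_self_sqrt (nsqM_nonneg (Ω := Ω) (gradV Ω v))
  -- Multiplying `c ‖∇v‖ ≤ ‖𝔻(v)‖ ≤ ‖∇v‖` by `‖∇v‖` gives `c ‖∇v‖² ≤ ‖∇v‖²`, whatever the sign of
  -- `c`.
  have h4 := mul_le_mul_of_nonneg_right (h.trans h2) (Real.sqrt_nonneg (nsqM Ω (gradV Ω v)))
  rw [mul_assoc, h3] at h4
  exact h4.trans h1

end Korn

/-! ### Vector identities -/

section Vectors

variable {d : ℕ} {Ω : Set (Pt d)}

lemma memLp_curl {v : Vec d} (hv : ∀ i, MemH1 Ω (fun x => v x i)) (i : Fin 3) :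
    MemLp (fun x => curl Ω v x i) 2 (volume.restrict Ω) := by
  have h : ∀ k l, MemLp (fun x => padM (gradV Ω v x) k l) 2 (volume.restrict Ω) := by
    intro k l
    by_cases hkl : (k : ℕ) < d ∧ (l : ℕ) < d
    · simp only [padM, dif_pos hkl]
      exact memLp_gradV hv _ _
    · simp only [padM, dif_neg hkl]
      exact MemLp.zero
  fin_cases i
  · exact (h 2 1).sub (h 1 2)
  · exact (h 0 2).sub (h 2 0)
  · exact (h 1 0).sub (h 0 1)

/-- The triple product is cyclic at every point, so the integrands agree and no integrability of the
cubic terms is required. -/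
lemma cHat_eq_cTilde (H B v : Vec d) : cHat Ω H B v = cTilde Ω v H B := by
  simp only [cHat, cTilde]
  congr 1 with x
  rw [dotProduct_comm, triple_product_permutation, triple_product_permutation, dotProduct_comm]

lemma bForm_self (w u : Vec d) : bForm Ω w u u = 0 := by
  simp [bForm]

lemma ipV_smul_grad (f g : Scal d) (v : Vec d) :
    ipV Ω (fun x => f x • grad Ω g x) v = ipS Ω (fun x => grad Ω g x ⬝ᵥ v x) f := by
  simp only [ipV, ipS, smul_dotProduct, smul_eq_mul, mul_comm]

end Vectors

/-! ### Time differences -/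

section TimeDifference

variable {d : ℕ} {Ω : Set (Pt d)} {Δt : ℝ}

lemma mul_ipV_dt (hΔt : Δt ≠ 0) {v : ℕ → Vec d} {m : ℕ}
    (h : ∀ i, MemLp (fun x => v m x i) 2 (volume.restrict Ω))
    (h' : ∀ i, MemLp (fun x => v (m + 1) x i) 2 (volume.restrict Ω)) :
    Δt * ipV Ω (dt Δt v m) (v (m + 1))
      = 1 / 2 * nsqV Ω (v (m + 1)) - 1 / 2 * nsqV Ω (v m)
        + Δt ^ 2 * (1 / 2 * nsqV Ω (dt Δt v m)) := by
  have e1 : ipV Ω (dt Δt v m) (v (m + 1))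
      = Δt⁻¹ * ∫ x in Ω, (v (m + 1) x - v m x) ⬝ᵥ v (m + 1) x := by
    rw [ipV, ← integral_const_mul]
    congr 1 with x
    simp only [dt, Pi.smul_apply, Pi.sub_apply, smul_dotProduct, smul_eq_mul]
  have e2 : nsqV Ω (dt Δt v m)
      = Δt⁻¹ ^ 2 * ∫ x in Ω, (v (m + 1) x - v m x) ⬝ᵥ (v (m + 1) x - v m x) := by
    rw [nsqV, ← integral_const_mul]
    congr 1 with x
    simp only [dt, Pi.smul_apply, Pi.sub_apply, smul_dotProduct, dotProduct_smul, smul_eq_mul]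
    ring
  rw [e1, e2, integral_sub_dotProduct_self h' h, nsqV, nsqV]
  field_simp

lemma mul_ipV_grad_dt (hΩ : IsOpen Ω) (hΔt : Δt ≠ 0) {f : ℕ → Scal d} {m : ℕ}
    (h : MemH1 Ω (f m)) (h' : MemH1 Ω (f (m + 1))) :
    Δt * ipV Ω (grad Ω (f (m + 1))) (grad Ω (dt Δt f m))
      = 1 / 2 * nsqV Ω (grad Ω (f (m + 1))) - 1 / 2 * nsqV Ω (grad Ω (f m))
        + Δt ^ 2 * (1 / 2 * nsqV Ω (grad Ω (dt Δt f m))) := by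
  have hae := grad_smul_sub_ae hΩ h' h Δt⁻¹
  have e1 : ipV Ω (grad Ω (f (m + 1))) (grad Ω (dt Δt f m))
      = ipV Ω (dt Δt (fun k => grad Ω (f k)) m) (grad Ω (f (m + 1))) := by
    refine integral_congr_ae ?_
    filter_upwards [hae] with x hx
    rw [dt, hx, dotProduct_comm, dt]
  have e2 : nsqV Ω (grad Ω (dt Δt f m)) = nsqV Ω (dt Δt (fun k => grad Ω (f k)) m) := by
    refine integral_congr_ae ?_
    filter_upwards [hae] with x hx
    rw [dt, hx, dt]
  rw [e1, e2]
  exact mul_ipV_dt (v := fun k => grad Ω (f k)) hΔt h.isWeakGrad.1 h'.isWeakGrad.1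

lemma IsConvexPolytope.isCompact_closure (hΩ : IsConvexPolytope Ω) : IsCompact (closure Ω) := by
  obtain ⟨V, hV⟩ := hΩ.2.2
  rw [hV]
  exact V.finite_toSet.isCompact_convexHull (𝕜 := ℝ)

/-- The quartic terms in `φ` are integrable by continuity on a compact set, so no Sobolev embedding
is involved. -/
lemma integrable_of_continuousOn_closure (hΩ : IsCompact (closure Ω)) {f : Scal d}
    (hf : ContinuousOn f (closure Ω)) : Integrable f (volume.restrict Ω) :=
  (hf.integrableOn_compact hΩ).mono_set subset_closure

/-- The pointwise convex-splitting identity with `a = f (m + 1)` and `b = f m`, integrated. -/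
lemma mul_ipS_dt_double_well (hΩ : IsCompact (closure Ω)) (hΔt : Δt ≠ 0) {f : ℕ → Scal d} {m : ℕ}
    (h : ContinuousOn (f m) (closure Ω)) (h' : ContinuousOn (f (m + 1)) (closure Ω)) :
    Δt * ipS Ω (fun x => f (m + 1) x ^ 3 - f m x) (dt Δt f m)
      = 1 / 4 * (∫ x in Ω, (1 - f (m + 1) x ^ 2) ^ 2) - 1 / 4 * (∫ x in Ω, (1 - f m x ^ 2) ^ 2)
        + Δt ^ 2 * (1 / 4 * nsqS Ω (dt Δt (fun k => f k ^ 2) m)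
          + 1 / 2 * nsqS Ω (f (m + 1) * dt Δt f m) + 1 / 2 * nsqS Ω (dt Δt f m)) := by
  have hc : ∀ {g : Scal d}, ContinuousOn g (closure Ω) → Integrable g (volume.restrict Ω) :=
    fun hg => integrable_of_continuousOn_closure hΩ hg
  have i1 : Integrable (fun x => (1 - f (m + 1) x ^ 2) ^ 2) (volume.restrict Ω) :=
    hc ((continuousOn_const.sub (h'.pow 2)).pow 2)
  have i2 : Integrable (fun x => (1 - f m x ^ 2) ^ 2) (volume.restrict Ω) :=
    hc ((continuousOn_const.sub (h.pow 2)).pow 2)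
  have hdt := (h'.sub h).const_smul Δt⁻¹
  have i3 : Integrable (fun x => dt Δt (fun k => f k ^ 2) m x ^ 2) (volume.restrict Ω) :=
    hc ((((h'.pow 2).sub (h.pow 2)).const_smul Δt⁻¹).pow 2)
  have i4 : Integrable (fun x => (f (m + 1) * dt Δt f m) x ^ 2) (volume.restrict Ω) :=
    hc ((h'.mul hdt).pow 2)
  have i5 : Integrable (fun x => dt Δt f m x ^ 2) (volume.restrict Ω) := hc (hdt.pow 2)
  have i12 : Integrable (fun x => 1 / 4 * (1 - f (m + 1) x ^ 2) ^ 2 - 1 / 4 * (1 - f m x ^ 2) ^ 2)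
      (volume.restrict Ω) := (i1.const_mul (1 / 4)).sub (i2.const_mul (1 / 4))
  have i34 := (i3.const_mul (1 / 4)).fun_add (i4.const_mul (1 / 2))
  have i345 := i34.fun_add (i5.const_mul (1 / 2))
  simp only [ipS, nsqS]
  rw [← integral_const_mul, ← integral_const_mul, ← integral_const_mul, ← integral_const_mul,
    ← integral_const_mul, ← integral_const_mul,
    ← integral_sub (i1.const_mul _) (i2.const_mul _),
    ← integral_add (i3.const_mul _) (i4.const_mul _), ← integral_add i34 (i5.const_mul _),
    ← integral_const_mul, ← integral_add i12 (i345.const_mul _)]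
  congr 1 with x
  simp only [dt, Pi.smul_apply, Pi.sub_apply, Pi.mul_apply, Pi.pow_apply,
    smul_eq_mul]
  field_simp
  ring

end TimeDifference

/-! ### Finite element spaces -/

section FiniteElements

variable {d : ℕ} {Ω : Set (Pt d)} {K : Geometry.SimplicialComplex ℝ (Pt d)} {r : ℕ}

lemma IsPolyOn.smul_sub {k : ℕ} {s : Finset (Pt d)} {f g : Scal d} {p q : MvPolynomial (Fin d) ℝ}
    (hf : IsPolyOn k s f p) (hg : IsPolyOn k s g q) (c : ℝ) :
    IsPolyOn k s (c • (f - g)) (c • (p - q)) := by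
  refine ⟨(MvPolynomial.totalDegree_smul_le _ _).trans
    ((MvPolynomial.totalDegree_sub _ _).trans (max_le hf.1 hg.1)), fun x hx => ?_⟩
  simp [hf.2 x hx, hg.2 x hx]

lemma fespaceQ.smul_sub {f g : Scal d} (hf : f ∈ fespaceQ Ω K r) (hg : g ∈ fespaceQ Ω K r)
    (c : ℝ) : c • (f - g) ∈ fespaceQ Ω K r := by
  refine ⟨hf.1.smul_sub hg.1 c, (hf.2.1.sub hg.2.1).const_smul c, fun s hs hcard => ?_⟩
  obtain ⟨p, hp⟩ := hf.2.2 s hs hcard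
  obtain ⟨q, hq⟩ := hg.2.2 s hs hcard
  exact ⟨_, hp.smul_sub hq c⟩

/-- The normal derivative is linear in the polynomial. This makes `δ_t φ` an admissible test
function. -/
lemma fespaceQNeumann.smul_sub {f g : Scal d} (hf : f ∈ fespaceQNeumann Ω K r)
    (hg : g ∈ fespaceQNeumann Ω K r) (c : ℝ) : c • (f - g) ∈ fespaceQNeumann Ω K r := by
  refine ⟨fespaceQ.smul_sub hf.1 hg.1 c, fun s hs hcard => ?_⟩
  obtain ⟨p, hp, hp'⟩ := hf.2 s hs hcard
  obtain ⟨q, hq, hq'⟩ := hg.2 s hs hcard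
  refine ⟨_, hp.smul_sub hq c, fun t ht htc htf n hn x hx => ?_⟩
  have h1 := hp' t ht htc htf n hn x hx
  have h2 := hq' t ht htc htf n hn x hx
  simp only [Derivation.map_smul, map_sub, MvPolynomial.smul_eval, mul_sub, sub_mul, mul_assoc,
    Finset.sum_sub_distrib, ← Finset.mul_sum, h1, h2, mul_zero, sub_zero]

end FiniteElements

/-! ### Coefficients -/

section Coefficients

variable {d : ℕ} {Ω : Set (Pt d)} {T Δt k₁ k₂ : ℝ} {k : Pt d → ℝ → ℝ → ℝ} {φ : ℕ → Scal d} {m : ℕ}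

lemma IsCoeff.continuousOn_coeffAt (hk : IsCoeff Ω T k k₁ k₂)
    (ht : ((m + 1 : ℕ) : ℝ) * Δt ∈ Set.Ioc 0 T) (hφ : ContinuousOn (φ m) (closure Ω)) :
    ContinuousOn (coeffAt Δt k φ m) (closure Ω) := by
  have h : ContinuousOn (fun x : Pt d => (x, ((m + 1 : ℕ) : ℝ) * Δt, φ m x)) (closure Ω) :=
    continuousOn_id.prodMk (continuousOn_const.prodMk hφ)
  exact hk.1.comp h fun x hx => ⟨hx, Set.Ioc_subset_Icc_self ht, Set.mem_univ _⟩

lemma IsCoeff.integrable_coeffAt_mul (hΩ : IsOpen Ω) (hk : IsCoeff Ω T k k₁ k₂)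
    (ht : ((m + 1 : ℕ) : ℝ) * Δt ∈ Set.Ioc 0 T) (hφ : ContinuousOn (φ m) (closure Ω))
    {g : Scal d} (hg : Integrable g (volume.restrict Ω)) :
    Integrable (fun x => coeffAt Δt k φ m x * g x) (volume.restrict Ω) := by
  refine hg.bdd_mul (c := k₂) (((hk.continuousOn_coeffAt ht hφ).mono
    subset_closure).aestronglyMeasurable hΩ.measurableSet) ?_
  refine (ae_restrict_mem hΩ.measurableSet).mono fun x hx => ?_
  obtain ⟨h1, h2⟩ := hk.2.2 x (subset_closure hx) _ ht (φ m x)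
  rw [Real.norm_eq_abs]
  exact (abs_of_nonneg (hk.2.1.le.trans h1)).le.trans h2

lemma IsCoeff.mul_integral_le (hΩ : IsOpen Ω) (hk : IsCoeff Ω T k k₁ k₂)
    (ht : ((m + 1 : ℕ) : ℝ) * Δt ∈ Set.Ioc 0 T) (hφ : ContinuousOn (φ m) (closure Ω))
    {g : Scal d} (hg : Integrable g (volume.restrict Ω)) (hg0 : ∀ x, 0 ≤ g x) :
    k₁ * ∫ x in Ω, g x ≤ ∫ x in Ω, coeffAt Δt k φ m x * g x := by
  rw [← integral_const_mul]
  refine integral_mono_ae (hg.const_mul _) (hk.integrable_coeffAt_mul hΩ ht hφ hg) ?_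
  refine (ae_restrict_mem hΩ.measurableSet).mono fun x hx => ?_
  exact mul_le_mul_of_nonneg_right (hk.2.2 x (subset_closure hx) _ ht (φ m x)).1 (hg0 x)

lemma real_dotProduct_self_nonneg {n : ℕ} (v : Fin n → ℝ) : 0 ≤ v ⬝ᵥ v :=
  Finset.sum_nonneg fun _ _ => mul_self_nonneg _

lemma nsqV_nonneg {n : ℕ} (v : Pt d → Fin n → ℝ) : 0 ≤ nsqV Ω v :=
  integral_nonneg fun x => real_dotProduct_self_nonneg (v x)

lemma nsqS_nonneg (f : Scal d) : 0 ≤ nsqS Ω f :=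
  integral_nonneg fun _ => sq_nonneg _

lemma IsCoeff.mul_nsqV_grad_le_aPhi (hΩ : IsOpen Ω) (hk : IsCoeff Ω T k k₁ k₂)
    (ht : ((m + 1 : ℕ) : ℝ) * Δt ∈ Set.Ioc 0 T) (hφ : ContinuousOn (φ m) (closure Ω))
    {f : Scal d} (hf : MemH1 Ω f) :
    k₁ * nsqV Ω (grad Ω f) ≤ aPhi Ω (coeffAt Δt k φ m) f f :=
  hk.mul_integral_le hΩ ht hφ (integrable_dotProduct hf.isWeakGrad.1 hf.isWeakGrad.1)
    fun _ => real_dotProduct_self_nonneg _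

lemma IsCoeff.mul_nsqM_strain_le_aF (hΩ : IsOpen Ω) (hk : IsCoeff Ω T k k₁ k₂)
    (ht : ((m + 1 : ℕ) : ℝ) * Δt ∈ Set.Ioc 0 T) (hφ : ContinuousOn (φ m) (closure Ω))
    {v : Vec d} (hv : ∀ i, MemH1 Ω (fun x => v x i)) :
    k₁ * (2 * nsqM Ω (strain Ω v)) ≤ aF Ω (coeffAt Δt k φ m) v v := by
  have h := hk.mul_integral_le hΩ ht hφ (integrable_frob (memLp_strain hv) (memLp_strain hv))
    fun _ => frob_self_nonneg _
  have e : aF Ω (coeffAt Δt k φ m) v v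
      = 2 * ∫ x in Ω, coeffAt Δt k φ m x * frob (strain Ω v x) (strain Ω v x) := by
    rw [aF, ← integral_const_mul]
    simp only [mul_assoc]
  rw [e, mul_left_comm]
  exact mul_le_mul_of_nonneg_left h zero_le_two

lemma IsCoeff.mul_nsqV_curl_add_nsqS_div_le_aB (hΩ : IsOpen Ω) (hk : IsCoeff Ω T k k₁ k₂)
    (ht : ((m + 1 : ℕ) : ℝ) * Δt ∈ Set.Ioc 0 T) (hφ : ContinuousOn (φ m) (closure Ω))
    {v : Vec d} (hv : ∀ i, MemH1 Ω (fun x => v x i)) :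
    k₁ * (nsqV Ω (curl Ω v) + nsqS Ω (div Ω v)) ≤ aB Ω (coeffAt Δt k φ m) v v := by
  have h1 := hk.mul_integral_le hΩ ht hφ (integrable_dotProduct (memLp_curl hv) (memLp_curl hv))
    fun _ => real_dotProduct_self_nonneg _
  have h2 := hk.mul_integral_le hΩ ht hφ (memLp_div hv).integrable_sq fun _ => sq_nonneg _
  rw [mul_add, aB]
  refine add_le_add h1 ?_
  simpa only [nsqS, sq] using h2

end Coefficients

/-! ### The energy balance of one time step -/

section Energy

variable {d : ℕ} {Ω : Set (Pt d)}

lemma energy_eq (hΩ : IsCompact (closure Ω)) {ε lam Sc : ℝ} {φ : Scal d} {u B : Vec d}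
    (hφ : MemH1 Ω φ) (hφc : ContinuousOn φ (closure Ω))
    (hu : ∀ i, MemH1 Ω (fun x => u x i)) (hB : ∀ i, MemH1 Ω (fun x => B x i)) :
    energy Ω ε lam Sc φ u B = 1 / 2 * nsqV Ω u + Sc / 2 * nsqV Ω B
      + lam * ε / 2 * nsqV Ω (grad Ω φ) + lam / (4 * ε) * ∫ x in Ω, (1 - φ x ^ 2) ^ 2 := by
  have i1 := (integrable_dotProduct (fun i => (hu i).1) fun i => (hu i).1).const_mul (1 / 2)
  have i2 := (integrable_dotProduct (fun i => (hB i).1) fun i => (hB i).1).const_mul (Sc / 2)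
  have i3 := (integrable_dotProduct hφ.isWeakGrad.1 hφ.isWeakGrad.1).const_mul (lam * ε / 2)
  have i4 : Integrable (fun x => lam / (4 * ε) * (1 - φ x ^ 2) ^ 2) (volume.restrict Ω) :=
    integrable_of_continuousOn_closure hΩ
      (continuousOn_const.mul ((continuousOn_const.sub (hφc.pow 2)).pow 2))
  have i12 := i1.fun_add i2
  have i123 := i12.fun_add i3
  simp only [nsqV]
  rw [← integral_const_mul, ← integral_const_mul, ← integral_const_mul, ← integral_const_mul,
    ← integral_add i1 i2, ← integral_add i12 i3, ← integral_add i123 i4]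
  rfl

variable {K : Geometry.SimplicialComplex ℝ (Pt d)} {r : ℕ} {Qh : Set (Scal d)}
  {ε lam Sc Δt : ℝ} {N : ℕ} {κ ν η : Pt d → ℝ → ℝ → ℝ} {φ μ : ℕ → Scal d} {u : ℕ → Vec d}
  {p : ℕ → Scal d} {B : ℕ → Vec d}

/-- The numerical dissipation of the step from `m` to `m + 1`, up to the factor `Δt ^ 2`. -/
noncomputable def numDissipation (Ω : Set (Pt d)) (ε lam Sc Δt : ℝ) (φ : ℕ → Scal d)
    (u B : ℕ → Vec d) (m : ℕ) : ℝ :=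
  lam * ε / 2 * nsqV Ω (grad Ω (dt Δt φ m)) + 1 / 2 * nsqV Ω (dt Δt u m)
    + Sc / 2 * nsqV Ω (dt Δt B m) + lam / (4 * ε) * nsqS Ω (dt Δt (fun k => φ k ^ 2) m)
    + lam / (2 * ε) * nsqS Ω (φ (m + 1) * dt Δt φ m) + lam / (2 * ε) * nsqS Ω (dt Δt φ m)

lemma numDissipation_nonneg (hε : 0 < ε) (hlam : 0 < lam) (hSc : 0 < Sc) (m : ℕ) :
    0 ≤ numDissipation Ω ε lam Sc Δt φ u B m := by
  have h1 := nsqV_nonneg (Ω := Ω) (grad Ω (dt Δt φ m))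
  have h2 := nsqV_nonneg (Ω := Ω) (dt Δt u m)
  have h3 := nsqV_nonneg (Ω := Ω) (dt Δt B m)
  have h4 := nsqS_nonneg (Ω := Ω) (dt Δt (fun k => φ k ^ 2) m)
  have h5 := nsqS_nonneg (Ω := Ω) (φ (m + 1) * dt Δt φ m)
  have h6 := nsqS_nonneg (Ω := Ω) (dt Δt φ m)
  unfold numDissipation
  positivity

lemma IsSolution.energy_balance (hΩ : IsOpen Ω) (hΩc : IsCompact (closure Ω))
    (hQ : Qh ⊆ fespaceQ Ω K r) (hQsub : ∀ f ∈ Qh, ∀ g ∈ Qh, ∀ c : ℝ, c • (f - g) ∈ Qh)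
    (hε : ε ≠ 0) (hΔt : Δt ≠ 0)
    (hsol : IsSolution Ω Qh (fespaceX Ω K r) (fespaceM Ω K r) (fespaceW Ω K r) ε lam Sc Δt N
      κ ν η φ μ u p B) {m : ℕ} (hm : m < N) :
    energy Ω ε lam Sc (φ (m + 1)) (u (m + 1)) (B (m + 1))
      + Δt * (lam * ε * aPhi Ω (coeffAt Δt κ φ m) (μ (m + 1)) (μ (m + 1))
        + aF Ω (coeffAt Δt ν φ m) (u (m + 1)) (u (m + 1))
        + Sc * aB Ω (coeffAt Δt η φ m) (B (m + 1)) (B (m + 1)))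
      + Δt ^ 2 * numDissipation Ω ε lam Sc Δt φ u B m
      = energy Ω ε lam Sc (φ m) (u m) (B m) := by
  have hφ := hsol.phi_mem m hm.le
  have hφ' := hsol.phi_mem (m + 1) hm
  have hu := fun i => ((hsol.u_mem m hm.le).1 i).1
  have hu' := fun i => ((hsol.u_mem (m + 1) hm).1 i).1
  have hB := (hsol.B_mem m hm.le).1.1
  have hB' := (hsol.B_mem (m + 1) hm).1.1
  have q1 := hsol.eq_phi m hm _ (hsol.mu_mem m hm)
  have q2 := hsol.eq_mu m hm (dt Δt φ m) (hQsub _ hφ' _ hφ _)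
  have q3 := hsol.eq_u m hm _ (hsol.u_mem (m + 1) hm)
  have q4 := hsol.eq_div m hm _ (hsol.p_mem m hm)
  have q5 := hsol.eq_B m hm _ (hsol.B_mem (m + 1) hm)
  have q6 : ipS Ω (μ (m + 1)) (dt Δt φ m) = ipS Ω (dt Δt φ m) (μ (m + 1)) := by
    simp only [ipS, mul_comm]
  -- Convection and pressure drop out; the Lorentz and capillary terms take the form in which they
  -- occur in `q5` and `q1`.
  rw [bForm_self, cHat_eq_cTilde, ipV_smul_grad, q4] at q3
  rw [q6] at q2
  have e1 := mul_ipV_grad_dt hΩ hΔt (hQ hφ).1 (hQ hφ').1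
  have e2 := mul_ipS_dt_double_well hΩc hΔt (hQ hφ).2.1 (hQ hφ').2.1
  have e3 := mul_ipV_dt hΔt (fun i => (hu i).1) fun i => (hu' i).1
  have e4 := mul_ipV_dt hΔt (fun i => (hB i).1) fun i => (hB' i).1
  rw [energy_eq hΩc (hQ hφ).1 (hQ hφ).2.1 hu hB, energy_eq hΩc (hQ hφ').1 (hQ hφ').2.1 hu' hB',
    numDissipation]
  have c4 : lam / (4 * ε) = lam * ε⁻¹ / 4 := by field_simp
  have c2 : lam / (2 * ε) = lam * ε⁻¹ / 2 := by field_simp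
  rw [c4, c2]
  linear_combination Δt * lam * q1 + Δt * lam * q2 + Δt * q3 + Δt * Sc * q5
    - lam * ε * e1 - lam * ε⁻¹ * e2 - e3 - Sc * e4

end Energy

end CHMHD

/-! ### Summation over the time steps -/

theorem theorem3 {d : ℕ} (hd : d = 2 ∨ d = 3)
    (Ω : Set (CHMHD.Pt d)) (hΩ : CHMHD.IsConvexPolytope Ω)
    (c₀ c₁ : ℝ) (hc₀ : CHMHD.IsKornConst Ω c₀) (hc₁ : CHMHD.IsCurlDivConst Ω c₁)
    (K : Geometry.SimplicialComplex ℝ (CHMHD.Pt d)) (hK : CHMHD.IsMesh Ω K) (r : ℕ)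
    (Qh : Set (CHMHD.Scal d))
    (hQh : Qh = CHMHD.fespaceQ Ω K r ∨ Qh = CHMHD.fespaceQNeumann Ω K r)
    (ε lam Sc T : ℝ) (hε : 0 < ε) (hlam : 0 < lam) (hSc : 0 < Sc) (hT : 0 < T)
    (κ ν η : CHMHD.Pt d → ℝ → ℝ → ℝ) (κ₁ κ₂ ν₁ ν₂ η₁ η₂ : ℝ)
    (hκ : CHMHD.IsCoeff Ω T κ κ₁ κ₂) (hν : CHMHD.IsCoeff Ω T ν ν₁ ν₂)
    (hη : CHMHD.IsCoeff Ω T η η₁ η₂)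
    (N : ℕ) (hN : 0 < N) (Δt : ℝ) (hΔt : Δt = T / N)
    (φ μ : ℕ → CHMHD.Scal d) (u : ℕ → CHMHD.Vec d) (p : ℕ → CHMHD.Scal d)
    (B : ℕ → CHMHD.Vec d)
    (hsol : CHMHD.IsSolution Ω Qh (CHMHD.fespaceX Ω K r) (CHMHD.fespaceM Ω K r)
      (CHMHD.fespaceW Ω K r) ε lam Sc Δt N κ ν η φ μ u p B) :
    (∀ n ≤ N,
      CHMHD.energy Ω ε lam Sc (φ n) (u n) (B n)
        + Δt * ∑ m ∈ Finset.range n,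
            (lam * κ₁ * ε * CHMHD.nsqV Ω (CHMHD.grad Ω (μ (m + 1)))
              + c₀ * ν₁ * CHMHD.nsqM Ω (CHMHD.gradV Ω (u (m + 1)))
              + Sc * c₁ * η₁ * CHMHD.nsqM Ω (CHMHD.gradV Ω (B (m + 1))))
        + Δt ^ 2 * ∑ m ∈ Finset.range n,
            (lam * ε / 2 * CHMHD.nsqV Ω (CHMHD.grad Ω (CHMHD.dt Δt φ m))
              + 1 / 2 * CHMHD.nsqV Ω (CHMHD.dt Δt u m)
              + Sc / 2 * CHMHD.nsqV Ω (CHMHD.dt Δt B m)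
              + lam / (4 * ε) * CHMHD.nsqS Ω (CHMHD.dt Δt (fun k => φ k ^ 2) m)
              + lam / (2 * ε) * CHMHD.nsqS Ω (φ (m + 1) * CHMHD.dt Δt φ m)
              + lam / (2 * ε) * CHMHD.nsqS Ω (CHMHD.dt Δt φ m))
        ≤ CHMHD.energy Ω ε lam Sc (φ 0) (u 0) (B 0)) ∧
    (∀ n < N, CHMHD.energy Ω ε lam Sc (φ (n + 1)) (u (n + 1)) (B (n + 1))
      ≤ CHMHD.energy Ω ε lam Sc (φ n) (u n) (B n)) := by
  obtain ⟨hΩo, -, -⟩ := id hΩ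
  have hΩc := hΩ.isCompact_closure
  have hNpos : (0 : ℝ) < N := Nat.cast_pos.2 hN
  have hΔt0 : 0 < Δt := hΔt ▸ div_pos hT hNpos
  have hQ : Qh ⊆ CHMHD.fespaceQ Ω K r := by
    rcases hQh with rfl | rfl
    · exact subset_rfl
    · exact fun f hf => hf.1
  have hQsub : ∀ f ∈ Qh, ∀ g ∈ Qh, ∀ c : ℝ, c • (f - g) ∈ Qh := by
    rcases hQh with rfl | rfl
    · exact fun f hf g hg c => CHMHD.fespaceQ.smul_sub hf hg c
    · exact fun f hf g hg c => CHMHD.fespaceQNeumann.smul_sub hf hg c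
  -- The coefficient bounds are assumed only for positive times up to `T`, so every `t_n` with `1 ≤
  -- n ≤ N` must lie there.
  have ht : ∀ m < N, ((m + 1 : ℕ) : ℝ) * Δt ∈ Set.Ioc 0 T := by
    intro m hm
    refine ⟨mul_pos (Nat.cast_pos.2 m.succ_pos) hΔt0, ?_⟩
    have h1 : ((m + 1 : ℕ) : ℝ) ≤ N := Nat.cast_le.2 hm
    have h2 : (N : ℝ) * Δt = T := by rw [hΔt]; field_simp
    rw [← h2]
    exact mul_le_mul_of_nonneg_right h1 hΔt0.le
  have hbal := fun m (hm : m < N) =>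
    hsol.energy_balance hΩo hΩc hQ hQsub hε.ne' hΔt0.ne' hm
  have hφc := fun m (hm : m < N) => (hQ (hsol.phi_mem m hm.le)).2.1
  have hA := fun m (hm : m < N) =>
    hκ.mul_nsqV_grad_le_aPhi hΩo (ht m hm) (hφc m hm) (hQ (hsol.mu_mem m hm)).1
  have hF := fun m (hm : m < N) =>
    hν.mul_nsqM_strain_le_aF hΩo (ht m hm) (hφc m hm) fun i => ((hsol.u_mem (m + 1) hm).1 i).1
  have hB := fun m (hm : m < N) =>
    hη.mul_nsqV_curl_add_nsqS_div_le_aB hΩo (ht m hm) (hφc m hm) (hsol.B_mem (m + 1) hm).1.1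
  constructor
  · intro n
    induction n with
    | zero => simp
    | succ m ih =>
      intro hm
      have ih := ih (Nat.le_of_succ_le hm)
      have h1 := mul_le_mul_of_nonneg_left (hA m hm) (mul_pos hlam hε).le
      have h2 := (mul_le_mul_of_nonneg_left (hc₀.mul_nsqM_gradV_le (hsol.u_mem (m + 1) hm).1)
        hν.2.1.le).trans (hF m hm)
      have h3 := mul_le_mul_of_nonneg_left ((mul_le_mul_of_nonneg_left
        (hc₁ _ (hsol.B_mem (m + 1) hm).1) hη.2.1.le).trans (hB m hm)) hSc.le
      have h4 := mul_le_mul_of_nonneg_left (add_le_add (add_le_add h1 h2) h3) hΔt0.le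
      have h5 := hbal m hm
      rw [CHMHD.numDissipation] at h5
      rw [Finset.sum_range_succ, Finset.sum_range_succ]
      linarith
  -- Monotonicity is read off the exact balance and not the summed law: `c₀` and `c₁` may be
  -- negative, whereas the forms `aPhi`, `aF` and `aB` are nonnegative on the diagonal.
  · intro n hn
    have h1 := (mul_nonneg hκ.2.1.le (CHMHD.nsqV_nonneg _)).trans (hA n hn)
    have h2 := (mul_nonneg hν.2.1.le (mul_nonneg zero_le_two (CHMHD.nsqM_nonneg _))).trans (hF n hn)
    have h3 := (mul_nonneg hη.2.1.le (add_nonneg (CHMHD.nsqV_nonneg _)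
      (CHMHD.nsqS_nonneg _))).trans (hB n hn)
    have h4 : 0 ≤ CHMHD.numDissipation Ω ε lam Sc Δt φ u B n :=
      CHMHD.numDissipation_nonneg hε hlam hSc n
    have h5 := hbal n hn
    have h6 := mul_nonneg hΔt0.le (add_nonneg (add_nonneg (mul_nonneg (mul_pos hlam hε).le h1) h2)
      (mul_nonneg hSc.le h3))
    have h7 := mul_nonneg (sq_nonneg Δt) h4
    linarith
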